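/- Write $\mathbb{N}=\{1,2,3,\dots\}$ and $e(x)=e^{2\pi i x}$. For a sequence $\boldsymbol a=(a_n)_{n\in\mathbb{N}}$ of complex numbers let $$E(\boldsymbol a)=\Bigl\{\alpha\in(0,1):\ \sup_{N\in\mathbb{N}}\Bigl|\sum_{1\le n\le N}a_n e(n\alpha)\Bigr|<+\infty\Bigr\}.$$ (1) Let $\boldsymbol a$ be a sequence of complex numbers taking only finitely many values. Assume that $i)$ $E(\boldsymbol a)$ contains a non-empty open interval, and $ii)$ $E(\boldsymbol a)$ contains $\mathbb{Q}\cap(0,1)$. Then $\boldsymbol a$ is ultimately constant, i.e. there are $c\in\mathbb{C}$ and $K$ with $a_n=c$ for all $n\ge K$. (2) If all the $a_n$ are real, the same conclusion holds with $ii)$ replaced by the condition that $E(\boldsymbol a)$ contains $\mathbb{Q}\cap(0,1/2]$. (3) In particular, there is no set $A\subset\mathbb{N}$, infinite and with infinite complement in $\mathbb{N}$, such that for every $\alpha\in(0,1)$ there is a constant $C_{A,\alpha}>0$ with $\bigl|\sum_{n\in A,\ n\le N}e(n\alpha)\bigr|\le C_{A,\alpha}$ for all $N\in\mathbb{N}$.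 -/

import Mathlib

namespace BoundedExpSums

/-- `e(x) = exp(2πix)`. -/
noncomputable def e (x : ℝ) : ℂ := Complex.exp (2 * (Real.pi : ℂ) * Complex.I * (x : ℂ))

/-- The exponential sum `∑_{1 ≤ n ≤ N} a_n e(nα)`. Natural numbers start at `1` here: the term
`a 0` is never used. -/
noncomputable def expSum (a : ℕ → ℂ) (α : ℝ) (N : ℕ) : ℂ :=
  ∑ n ∈ Finset.Icc 1 N, a n * e ((n : ℝ) * α)

/-- The set of the `α ∈ (0,1)` with `sup_N |∑_{n ≤ N} a_n e(nα)| < ∞`. -/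
def boundedSet (a : ℕ → ℂ) : Set ℝ :=
  {α | α ∈ Set.Ioo (0 : ℝ) 1 ∧ BddAbove (Set.range fun N : ℕ => ‖expSum a α N‖)}

open Classical in
/-- The exponential sum `S_A(α, N) = ∑_{n ∈ A, 1 ≤ n ≤ N} e(nα)`. -/
noncomputable def setExpSum (A : Set ℕ) (α : ℝ) (N : ℕ) : ℂ :=
  ∑ n ∈ Finset.Icc 1 N with n ∈ A, e ((n : ℝ) * α)

/-- The set `A` has bounded exponential sums over `E`: for each `α ∈ E` there is a bound that is
uniform in `N`. -/
def HasBES (A : Set ℕ) (E : Set ℝ) : Prop :=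
  ∀ α ∈ E, ∃ C : ℝ, 0 < C ∧ ∀ N : ℕ, ‖setExpSum A α N‖ ≤ C

/-- The set of values `{a_n : n ≥ 1}` is finite. -/
def FinitelyManyValues (a : ℕ → ℂ) : Prop := (a '' Set.Ici 1).Finite

/-- The set contains a non-empty open interval. -/
def ContainsOpenInterval (E : Set ℝ) : Prop := ∃ x y : ℝ, x < y ∧ Set.Ioo x y ⊆ E

/-- The sequence is constant from some index on. -/
def UltimatelyConstant (a : ℕ → ℂ) : Prop := ∃ c : ℂ, ∃ K : ℕ, ∀ n : ℕ, K ≤ n → a n = c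

end BoundedExpSums

/-!
A bounded coefficient sequence with finitely many values is ultimately periodic as soon as its
exponential sums are bounded on an interval (in the spirit of Szegő's theorem on power series with
finitely many coefficients), and boundedness at rational points then kills every nontrivial
frequency of the periodic tail.

By Baire's theorem the sums are uniformly bounded, by `M` say, on some interval of length `2δ`
(`exists_uniform_bound`). Let `φ` be a smooth bump supported in `(0, δ)` and let
`w j = ∫ φ(t) e(jt) dt`, a summable family. For `θ` in the first half of the interval, the smoothed
sums `c m = ∑ⱼ a_{m+j} w_j e(jθ)` are, up to phases, the Fourier coefficients of a limit of functions
bounded by `M`, so Bessel's inequality gives `∑ |c m|² ≤ M²` and `c m → 0`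
(`tendsto_smoothed_shift_zero`).

Suppose that no finite length of the past of the sequence determines its next term. Then there are
shifts `a_{n_k+j}` and `a_{m_k+j}` that agree for `-k ≤ j < 0` but not at `j = 0`. A limit `d` of
their differences along an ultrafilter vanishes for `j < 0`, has `d_0 ≠ 0` because only finitely
many values occur, and satisfies `∑_{j ≥ 0} d_j w_j e(jθ) = 0` for all `θ` in an interval. The power
series `∑ d_j w_j z^j` is continuous on the closed disc and vanishes on an arc, so the product of
finitely many of its rotations vanishes on the whole circle; the maximum principle forces
`d_0 w_0 = 0` (`eq_zero_of_tsum_eq_zero_on_arc`), a contradiction. So the next term is a function of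
a window of bounded length (`determined_by_past`), and the pigeonhole principle yields a period.

For a periodic tail of period `T` the bounded sums at the points `r / T` make the period polynomial
vanish at all nontrivial `T`-th roots of unity, so all its coefficients are equal
(`ultimatelyConstant_of_periodic`). For real sequences the set of good `α` is symmetric under
`α ↦ 1 - α`, and sets of integers are covered by their indicator functions.
-/

namespace BoundedExpSums

open Filter Topology MeasureTheory
open scoped Real FourierTransform SchwartzMap ContDiff

/-! ### The character `e` and exponential sums -/

theorem e_add (x y : ℝ) : e (x + y) = e x * e y := by
  simp only [e]
  rw [← Complex.exp_add]
  push_cast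
  ring_nf

theorem e_zero : e 0 = 1 := by simp [e]

theorem norm_e (x : ℝ) : ‖e x‖ = 1 := by
  have h : e x = Complex.exp (((2 * π * x : ℝ) : ℂ) * Complex.I) := by
    simp only [e]
    push_cast
    ring_nf
  rw [h, Complex.norm_exp_ofReal_mul_I]

theorem e_intCast (n : ℤ) : e n = 1 := by
  rw [e, Complex.exp_eq_one_iff]
  exact ⟨n, by push_cast; ring⟩

theorem e_natCast_mul (n : ℕ) (x : ℝ) : e (n * x) = e x ^ n := by
  simp only [e]
  rw [← Complex.exp_nat_mul]
  push_cast
  ring_nf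

theorem conj_e (x : ℝ) : (starRingEnd ℂ) (e x) = e (-x) := by
  simp only [e]
  rw [← Complex.exp_conj]
  simp [Complex.conj_ofNat]

theorem continuous_e : Continuous e := by
  unfold e
  fun_prop

theorem continuous_expSum (a : ℕ → ℂ) (N : ℕ) : Continuous fun α => expSum a α N := by
  unfold expSum
  exact continuous_finsetSum _ fun n _ =>
    continuous_const.mul (continuous_e.comp (continuous_const.mul continuous_id))

/-! ### A smooth bump with summable Fourier coefficients -/

/-- The Fourier coefficients of a smooth compactly supported function are values of a Schwartz
function, hence `O(j⁻²)`. -/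
theorem exists_bump {δ : ℝ} (hδ : 0 < δ) :
    ∃ φ : ℝ → ℂ, Continuous φ ∧ (∀ t, ‖φ t‖ ≤ 1) ∧ (∀ t, t ∉ Set.Ioo 0 δ → φ t = 0) ∧
      ∫ t, φ t ≠ 0 ∧ Summable fun j : ℤ => ‖∫ t, φ t * e (j * t)‖ := by
  let f : ContDiffBump (δ / 2 : ℝ) := ⟨δ / 4, δ / 2, by linarith, by linarith⟩
  have hcd : ContDiff ℝ ∞ fun t => (f t : ℂ) := Complex.ofRealCLM.contDiff.comp f.contDiff
  have hcs : HasCompactSupport fun t => (f t : ℂ) :=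
    f.hasCompactSupport.comp_left (g := fun r : ℝ => (r : ℂ)) (by simp)
  refine ⟨fun t => (f t : ℂ), hcd.continuous, fun t => ?_, fun t ht => ?_, ?_, ?_⟩
  · rw [Complex.norm_real, Real.norm_of_nonneg f.nonneg]
    exact f.le_one
  · have : t ∉ Function.support f := by
      rw [f.support_eq, Real.ball_eq_Ioo]
      simpa [f] using ht
    simpa using this
  · rw [integral_complex_ofReal]
    exact_mod_cast f.integral_pos.ne'
  · let F : 𝓢(ℝ, ℂ) := hcs.toSchwartzMap hcd
    have hF : ∀ j : ℤ, ∫ t, (f t : ℂ) * e (j * t) = (𝓕 F : 𝓢(ℝ, ℂ)) (-(j : ℝ)) := by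
      intro j
      rw [SchwartzMap.fourier_coe, Real.fourier_eq']
      refine integral_congr_ae (ae_of_all _ fun t => ?_)
      simp only [smul_eq_mul]
      rw [mul_comm]
      congr 1
      simp only [e, RCLike.inner_apply, conj_trivial]
      push_cast
      ring_nf
    obtain ⟨C, -, hC⟩ := (𝓕 F : 𝓢(ℝ, ℂ)).decay 2 0
    have hs : Summable fun j : ℤ => C * (1 / (j : ℝ) ^ 2) :=
      (Real.summable_one_div_int_pow.2 one_lt_two).mul_left C
    refine Summable.of_norm_bounded_eventually hs ?_
    filter_upwards [(Set.finite_singleton (0 : ℤ)).compl_mem_cofinite] with j hj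
    have hj' : (0 : ℝ) < (j : ℝ) ^ 2 := by
      have : (j : ℝ) ≠ 0 := by simpa using hj
      positivity
    have h := hC (-(j : ℝ))
    rw [norm_iteratedFDeriv_zero, norm_neg, Real.norm_eq_abs, sq_abs] at h
    rw [norm_norm, hF, mul_one_div, le_div_iff₀ hj', mul_comm]
    exact h

/-! ### Power series vanishing on an arc -/

/-- A power series whose coefficients are absolutely summable and whose sum vanishes on an arc of
the unit circle has constant term `0`. The product of its `K` rotations by `K`-th roots of unity,
with `1 / K` below the length of the arc, vanishes on the whole circle, hence at `0`. -/
theorem eq_zero_of_tsum_eq_zero_on_arc {b : ℕ → ℂ} (hb : Summable fun j => ‖b j‖) {x δ : ℝ}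
    (hδ : 0 < δ) (h : ∀ θ ∈ Set.Icc x (x + δ), ∑' j, b j * e θ ^ j = 0) : b 0 = 0 := by
  obtain ⟨k, hk⟩ := exists_nat_one_div_lt hδ
  set K : ℕ := k + 1 with hK
  have hK0 : (0 : ℝ) < K := by positivity
  have hKδ : 1 / (K : ℝ) < δ := by simpa [hK] using hk
  let f : ℂ → ℂ := fun z => ∑' j, b j * z ^ j
  have hle : ∀ (j : ℕ) (z : ℂ), z ∈ Metric.closedBall (0 : ℂ) 1 → ‖b j * z ^ j‖ ≤ ‖b j‖ := by
    intro j z hz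
    rw [norm_mul, norm_pow]
    exact mul_le_of_le_one_right (norm_nonneg _)
      (pow_le_one₀ (norm_nonneg _) (by simpa using hz))
  have hf : DiffContOnCl ℂ f (Metric.ball 0 1) := by
    refine ⟨?_, ?_⟩
    · exact Complex.differentiableOn_tsum_of_summable_norm hb (fun j => by fun_prop)
        Metric.isOpen_ball fun j z hz => hle j z (Metric.ball_subset_closedBall hz)
    · rw [closure_ball _ one_ne_zero]
      exact continuousOn_tsum (fun j => by fun_prop) hb hle
  have hrot : ∀ i : ℕ, DiffContOnCl ℂ (fun z => f (e (i / K) * z)) (Metric.ball 0 1) := by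
    intro i
    refine hf.comp (g := fun z => e (i / K) * z) (Differentiable.diffContOnCl (by fun_prop)) ?_
    intro z hz
    simpa [norm_e] using hz
  let G : ℂ → ℂ := fun z => ∏ i ∈ Finset.range K, f (e (i / K) * z)
  have hG : DiffContOnCl ℂ G (Metric.ball 0 1) := by
    refine ⟨?_, ?_⟩
    · exact DifferentiableOn.fun_finsetProd fun i _ => (hrot i).1
    · exact continuousOn_finsetProd _ fun i _ => (hrot i).2
  have hfront : Set.EqOn G (fun _ => 0) (frontier (Metric.ball (0 : ℂ) 1)) := by
    intro z hz
    rw [frontier_ball _ one_ne_zero, mem_sphere_zero_iff_norm] at hz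
    obtain ⟨θ, rfl⟩ : ∃ θ : ℝ, e θ = z := by
      refine ⟨z.arg / (2 * π), ?_⟩
      have h1 := Complex.norm_mul_exp_arg_mul_I z
      rw [hz, Complex.ofReal_one, one_mul] at h1
      conv_rhs => rw [← h1]
      rw [e]
      congr 1
      have : (π : ℂ) ≠ 0 := by exact_mod_cast Real.pi_ne_zero
      push_cast
      field_simp
    -- Rotating by `l / K` moves `θ` to `x + fract (K (θ - x)) / K`, within `1 / K` of `x`; only
    -- the residue of `l` modulo `K` matters.
    let l : ℤ := -⌊K * (θ - x)⌋
    have hl0 : 0 ≤ l % (K : ℤ) := Int.emod_nonneg _ (by omega)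
    have hl1 : l % (K : ℤ) < K := Int.emod_lt_of_pos _ (by omega)
    refine Finset.prod_eq_zero (i := (l % (K : ℤ)).toNat) (by simp; omega) ?_
    have hcast : (((l % (K : ℤ)).toNat : ℕ) : ℝ) = ((l % (K : ℤ) : ℤ) : ℝ) := by
      exact_mod_cast congrArg (Int.cast (R := ℝ)) (Int.toNat_of_nonneg hl0)
    have hdiv : ((l % (K : ℤ) : ℤ) : ℝ) = l - K * (l / (K : ℤ) : ℤ) := by
      rw [Int.emod_def]; push_cast; ring
    have he : e (((l % (K : ℤ)).toNat : ℕ) / K) * e θ = e (θ + l / K) := by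
      have h1 : e (θ + l / K)
          = e (((l % (K : ℤ)).toNat : ℕ) / K) * e θ * e ((l / (K : ℤ) : ℤ) : ℝ) := by
        rw [← e_add, ← e_add, hcast, hdiv]
        congr 1
        field_simp
        ring
      rw [h1, e_intCast, mul_one]
    rw [he]
    refine h _ ?_
    have hfl := Int.floor_le (K * (θ - x))
    have hfl' := Int.lt_floor_add_one (K * (θ - x))
    have hlr : (l : ℝ) = -(⌊K * (θ - x)⌋ : ℝ) := by simp [l]
    have h2 : θ + l / K = x + (K * (θ - x) - ⌊K * (θ - x)⌋) / K := by
      rw [hlr]; field_simp; ring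
    rw [h2]
    have h3 : (K * (θ - x) - ⌊K * (θ - x)⌋) / K ≤ 1 / K := by
      gcongr
      linarith
    have h4 : 0 ≤ (K * (θ - x) - ⌊K * (θ - x)⌋) / K := div_nonneg (by linarith) hK0.le
    constructor <;> linarith
  have h0 := Complex.eqOn_closure_of_eqOn_frontier Metric.isBounded_ball hG
    diffContOnCl_const hfront (subset_closure (Metric.mem_ball_self one_pos))
  have hf0 : f 0 = b 0 := by
    simp only [f]
    rw [tsum_eq_single 0 (fun j hj => by simp [hj])]
    simp
  simp only [G, mul_zero, hf0, Finset.prod_const, Finset.card_range] at h0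
  exact pow_eq_zero_iff (by simp [hK]) |>.1 h0

/-! ### Smoothed sums tend to zero -/

/-- The two-sided sequence that is `a i` for `i ≥ 1` and `0` for `i ≤ 0`. -/
def zeroExtend (a : ℕ → ℂ) (i : ℤ) : ℂ := if 1 ≤ i then a i.toNat else 0

/-- Bessel's inequality on the circle `ℝ / ℤ`, for a function supported in an interval of length at
most `1`. -/
theorem sum_sq_norm_integral_le {g : ℝ → ℂ} (hg : Continuous g) {M δ : ℝ} (hδ : δ ≤ 1)
    (hM : ∀ t, ‖g t‖ ≤ M) (hsupp : ∀ t, t ∉ Set.Ioo 0 δ → g t = 0) (s : Finset ℤ) :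
    ∑ m ∈ s, ‖∫ t, e (-m * t) * g t‖ ^ 2 ≤ M ^ 2 := by
  have hL2 : MemLp g 2 (volume.restrict (Set.Ioc 0 1)) :=
    MemLp.of_bound hg.aestronglyMeasurable M (ae_of_all _ hM)
  have hsum := hasSum_sq_fourierCoeffOn (zero_lt_one' ℝ) hL2
  have hcoeff : ∀ m : ℤ, fourierCoeffOn (zero_lt_one' ℝ) g m = ∫ t, e (-m * t) * g t := by
    intro m
    rw [fourierCoeffOn_eq_integral, sub_zero, one_div_one, one_smul,
      intervalIntegral.integral_of_le zero_le_one]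
    rw [setIntegral_eq_integral_of_forall_compl_eq_zero]
    · refine integral_congr_ae (ae_of_all _ fun t => ?_)
      simp only [smul_eq_mul]
      congr 1
      rw [fourier_coe_apply, e]
      push_cast
      ring_nf
    · intro t ht
      rw [hsupp t, smul_zero]
      exact fun h => ht ⟨h.1, h.2.le.trans hδ⟩
  have h1 := sum_le_hasSum s (fun _ _ => by positivity) hsum
  simp only [hcoeff, sub_zero, inv_one, one_smul] at h1
  refine h1.trans ?_
  have h2 : ∫ x in (0 : ℝ)..1, ‖g x‖ ^ 2 ≤ ∫ x in (0 : ℝ)..1, M ^ 2 := by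
    refine intervalIntegral.integral_mono_on zero_le_one
      ((hg.norm.pow 2).intervalIntegrable _ _) (continuous_const.intervalIntegrable _ _) ?_
    intro t _
    exact pow_le_pow_left₀ (norm_nonneg _) (hM t) 2
  simpa using h2

theorem norm_zeroExtend_le {a : ℕ → ℂ} {B : ℝ} (hB : ∀ n, 1 ≤ n → ‖a n‖ ≤ B) (i : ℤ) :
    ‖zeroExtend a i‖ ≤ B := by
  unfold zeroExtend
  split_ifs with h
  · exact hB _ (by omega)
  · simpa using (norm_nonneg _).trans (hB 1 le_rfl)

theorem summable_mul_e {u w : ℤ → ℂ} {B : ℝ} (hu : ∀ j, ‖u j‖ ≤ B)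
    (hw : Summable fun j => ‖w j‖) (θ : ℝ) : Summable fun j : ℤ => u j * (w j * e (j * θ)) := by
  refine Summable.of_norm_bounded (hw.mul_left B) fun j => ?_
  rw [norm_mul, norm_mul, norm_e, mul_one]
  exact mul_le_mul_of_nonneg_right (hu j) (norm_nonneg _)

/-- Where the exponential sums of `a` are uniformly bounded, the shifts of `a` tend to zero after
smoothing by a bump function: the smoothed values are square-summable in the shift `m`. -/
theorem tendsto_smoothed_shift_zero {a : ℕ → ℂ} {B M δ θ : ℝ} (hB : ∀ n, 1 ≤ n → ‖a n‖ ≤ B)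
    (hδ0 : 0 < δ) (hδ : δ ≤ 1) (hM : ∀ t ∈ Set.Ioo 0 δ, ∀ N, ‖expSum a (θ + t) N‖ ≤ M)
    {φ : ℝ → ℂ} (hφ : Continuous φ) (hφ1 : ∀ t, ‖φ t‖ ≤ 1)
    (hφs : ∀ t, t ∉ Set.Ioo 0 δ → φ t = 0)
    {w : ℤ → ℂ} (hw : ∀ j, w j = ∫ t, φ t * e (j * t)) (hws : Summable fun j => ‖w j‖) :
    Tendsto (fun m : ℤ => ∑' j : ℤ, zeroExtend a (m + j) * (w j * e (j * θ)))
      cofinite (𝓝 0) := by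
  set c : ℤ → ℂ := fun m => ∑' j : ℤ, zeroExtend a (m + j) * (w j * e (j * θ)) with hc
  have hcomp : HasCompactSupport φ :=
    HasCompactSupport.intro (isCompact_Icc (a := 0) (b := δ)) fun t ht =>
      hφs t fun h => ht ⟨h.1.le, h.2.le⟩
  -- `c m` is the limit of its truncations to `n ≤ N`, written in the index `n = m + j`.
  have hlim : ∀ m : ℤ, Tendsto (fun N : ℕ => ∑ n ∈ Finset.Icc 1 N,
      a n * (w (n - m) * e ((n - m : ℤ) * θ))) atTop (𝓝 (c m)) := by
    intro m
    let F : ℤ → ℂ := fun i => zeroExtend a i * (w (i - m) * e ((i - m : ℤ) * θ))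
    have hsm : Summable fun j : ℤ => zeroExtend a (m + j) * (w j * e (j * θ)) :=
      summable_mul_e (fun j => norm_zeroExtend_le hB _) hws θ
    have hFj : (fun j : ℤ => zeroExtend a (m + j) * (w j * e (j * θ)))
        = F ∘ (Equiv.addLeft m) := by
      funext j
      simp [F]
    have hF : HasSum F (c m) := by
      rw [← (Equiv.addLeft m).hasSum_iff, ← hFj]
      exact hsm.hasSum
    have hFN : HasSum (F ∘ ((↑) : ℕ → ℤ)) (c m) := by
      rw [Function.Injective.hasSum_iff Nat.cast_injective]
      · exact hF
      · intro i hi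
        have : ¬ 1 ≤ i := fun h => hi ⟨i.toNat, by simp; omega⟩
        simp [F, zeroExtend, this]
    refine (hFN.tendsto_sum_nat.comp (tendsto_add_atTop_nat 1)).congr fun N => ?_
    have hsub : ∑ n ∈ Finset.Icc 1 N, F n = ∑ n ∈ Finset.range (N + 1), F n := by
      refine Finset.sum_subset (fun n hn => ?_) fun n hn hn' => ?_
      · simp at hn ⊢
        omega
      · have : n = 0 := by simp at hn hn'; omega
        simp [F, zeroExtend, this]
    refine hsub.symm.trans (Finset.sum_congr rfl fun n hn => ?_)
    have : 1 ≤ n := (Finset.mem_Icc.1 hn).1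
    simp [F, zeroExtend, this]
  -- The truncations are, up to the phase `e (-m θ)`, Fourier coefficients of `φ(t) S_N(θ + t)`.
  have hint : ∀ (m : ℤ) (N : ℕ), ∑ n ∈ Finset.Icc 1 N, a n * (w (n - m) * e ((n - m : ℤ) * θ))
      = e (-m * θ) * ∫ t, e (-m * t) * (φ t * expSum a (θ + t) N) := by
    intro m N
    have h1 : ∀ t, e (-m * t) * (φ t * expSum a (θ + t) N)
        = ∑ n ∈ Finset.Icc 1 N, a n * e (n * θ) * (φ t * e ((n - m : ℤ) * t)) := by
      intro t
      rw [expSum, Finset.mul_sum, Finset.mul_sum]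
      refine Finset.sum_congr rfl fun n _ => ?_
      have h2 : e ((n - m : ℤ) * t) = e (n * t) * e (-m * t) := by
        rw [← e_add]; congr 1; push_cast; ring
      rw [mul_add, e_add, h2]
      ring
    simp_rw [h1]
    rw [integral_finsetSum]
    · rw [Finset.mul_sum]
      refine Finset.sum_congr rfl fun n _ => ?_
      rw [integral_const_mul, ← hw]
      have h2 : e ((n - m : ℤ) * θ) = e (n * θ) * e (-m * θ) := by
        rw [← e_add]; congr 1; push_cast; ring
      rw [h2]
      ring
    · intro n _
      refine Integrable.const_mul ?_ _
      refine Continuous.integrable_of_hasCompactSupport ?_ hcomp.mul_right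
      exact hφ.mul (continuous_e.comp (by fun_prop))
  -- The bound `M ^ 2` given by Bessel is independent of `N` and survives the limit.
  have hM0 : 0 ≤ M := (norm_nonneg _).trans (hM (δ / 2) ⟨by linarith, by linarith⟩ 0)
  have hbound : ∀ s : Finset ℤ, ∑ m ∈ s, ‖c m‖ ^ 2 ≤ M ^ 2 := by
    intro s
    refine le_of_tendsto (tendsto_finsetSum s fun m _ => ((hlim m).norm.pow 2))
      (Eventually.of_forall fun N => ?_)
    simp_rw [hint, norm_mul, norm_e, one_mul]
    refine sum_sq_norm_integral_le (δ := δ) ?_ hδ ?_ ?_ s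
    · exact hφ.mul ((continuous_expSum a N).comp (by fun_prop))
    · intro t
      by_cases ht : t ∈ Set.Ioo 0 δ
      · rw [norm_mul]
        exact (mul_le_of_le_one_left (norm_nonneg _) (hφ1 t)).trans (hM t ht N)
      · rw [hφs t ht, zero_mul, norm_zero]
        exact hM0
    · intro t ht
      rw [hφs t ht, zero_mul]
  have hsq := (summable_of_sum_le (fun m => by positivity) hbound).tendsto_cofinite_zero
  rw [tendsto_zero_iff_norm_tendsto_zero]
  simpa using hsq.sqrt

theorem FinitelyManyValues.exists_norm_le {a : ℕ → ℂ} (ha : FinitelyManyValues a) :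
    ∃ B : ℝ, ∀ n, 1 ≤ n → ‖a n‖ ≤ B := by
  obtain ⟨B, hB⟩ := (Set.Finite.isBounded ha).exists_norm_le
  exact ⟨B, fun n hn => hB _ ⟨n, hn, rfl⟩⟩

/-! ### The past determines the next term -/

/-- If `a` takes finitely many values and its exponential sums are uniformly bounded on an interval,
then some fixed number `L` of consecutive terms determines the next one. -/
theorem determined_by_past {a : ℕ → ℂ} (ha : FinitelyManyValues a) {x δ M : ℝ}
    (hδ0 : 0 < δ) (hδ : δ ≤ 1)
    (hM : ∀ θ ∈ Set.Ioo x (x + 2 * δ), ∀ N, ‖expSum a θ N‖ ≤ M) :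
    ∃ L : ℕ, ∀ n m : ℕ, L < n → L < m → (∀ i, 1 ≤ i → i ≤ L → a (n - i) = a (m - i)) →
      a n = a m := by
  by_contra! hcon
  choose n m hn hm hpast hne using hcon
  obtain ⟨B, hB⟩ := ha.exists_norm_le
  obtain ⟨φ, hφ, hφ1, hφs, hφ0, hws⟩ := exists_bump hδ0
  set w : ℤ → ℂ := fun j => ∫ t, φ t * e (j * t) with hw
  -- A limit along a nonprincipal ultrafilter exists in every coordinate `j` at once.
  let U : Ultrafilter ℕ := hyperfilter ℕ
  have hU : (U : Filter ℕ) ≤ atTop := Nat.hyperfilter_le_atTop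
  let D : ℕ → ℤ → ℂ := fun k j => zeroExtend a (n k + j) - zeroExtend a (m k + j)
  have hD : ∀ k j, ‖D k j‖ ≤ B + B := fun k j =>
    (norm_sub_le _ _).trans (add_le_add (norm_zeroExtend_le hB _) (norm_zeroExtend_le hB _))
  have hex : ∀ j, ∃ z, Tendsto (fun k => D k j) U (𝓝 z) := by
    intro j
    obtain ⟨z, -, hz⟩ := (isCompact_closedBall (0 : ℂ) (B + B)).ultrafilter_le_nhds
      (U.map fun k => D k j) (le_principal_iff.2
        (Ultrafilter.mem_map.2 (univ_mem' fun k => by simpa using hD k j)))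
    exact ⟨z, hz⟩
  choose d hd using hex
  have hdneg : ∀ j, j < 0 → d j = 0 := by
    intro j hj
    refine tendsto_nhds_unique (hd j) ?_
    refine tendsto_const_nhds.congr' ?_
    filter_upwards [hU (eventually_ge_atTop (-j).toNat)] with k hk
    have h1 := hn k
    have h2 := hm k
    have h3 := hpast k (-j).toNat (by omega) hk
    have e1 : ((n k : ℤ) + j).toNat = n k - (-j).toNat := by omega
    have e2 : ((m k : ℤ) + j).toNat = m k - (-j).toNat := by omega
    simp only [D, zeroExtend]
    rw [if_pos (by omega), if_pos (by omega), e1, e2, h3, sub_self]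
  -- The differences `D k 0` lie in a finite set that omits `0`, and so does their limit.
  have hd0 : d 0 ≠ 0 := by
    have hfin : ((Set.image2 (fun y z => y - z) (a '' Set.Ici 1) (a '' Set.Ici 1)) \ {0}).Finite :=
      (Set.Finite.image2 _ ha ha).sdiff
    have hmem : d 0 ∈ (Set.image2 (fun y z => y - z) (a '' Set.Ici 1) (a '' Set.Ici 1)) \ {0} := by
      refine hfin.isClosed.mem_of_tendsto (hd 0) (Eventually.of_forall fun k => ?_)
      have h1 := hn k
      have h2 := hm k
      have h3 : D k 0 = a (n k) - a (m k) := by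
        simp only [D, zeroExtend, add_zero]
        rw [if_pos (by omega), if_pos (by omega)]
        simp
      rw [h3]
      exact ⟨⟨_, ⟨n k, by simp; omega, rfl⟩, _, ⟨m k, by simp; omega, rfl⟩, rfl⟩,
        sub_ne_zero.2 (hne k)⟩
    exact hmem.2
  have hdB : ∀ j, ‖d j‖ ≤ B + B := fun j =>
    le_of_tendsto (hd j).norm (Eventually.of_forall fun k => hD k j)
  have hcof : ∀ p : ℕ → ℕ, (∀ k, k < p k) → Tendsto (fun k => (p k : ℤ)) U cofinite := by
    intro p hp
    have h1 : Tendsto p atTop atTop := tendsto_atTop_mono (fun k => (hp k).le) tendsto_id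
    exact ((tendsto_natCast_atTop_atTop.comp h1).mono_right atTop_le_cofinite).mono_left hU
  -- Dominated convergence passes the smoothed sums of the shifts to `d`, and both shifts
  -- contribute `0`.
  have hzero : ∀ θ ∈ Set.Icc x (x + δ), ∑' j : ℕ, (d j * w j) * e θ ^ j = 0 := by
    intro θ hθ
    have hC := tendsto_smoothed_shift_zero (θ := θ) hB hδ0 hδ (fun t ht N =>
      hM _ ⟨by linarith [hθ.1, ht.1], by linarith [hθ.2, ht.2]⟩ N) hφ hφ1 hφs
      (fun j => rfl) hws
    have h0 : Tendsto (fun k => ∑' j : ℤ, D k j * (w j * e (j * θ))) U (𝓝 0) := by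
      have h := (hC.comp (hcof n hn)).sub (hC.comp (hcof m hm))
      rw [sub_zero] at h
      refine h.congr fun k => ?_
      simp only [Function.comp]
      rw [← Summable.tsum_sub (summable_mul_e (fun j => norm_zeroExtend_le hB _) hws θ)
        (summable_mul_e (fun j => norm_zeroExtend_le hB _) hws θ)]
      refine tsum_congr fun j => ?_
      simp only [D, sub_mul, hw]
    have h1 : Tendsto (fun k => ∑' j : ℤ, D k j * (w j * e (j * θ))) U
        (𝓝 (∑' j : ℤ, d j * (w j * e (j * θ)))) := by
      refine tendsto_tsum_of_dominated_convergence (hws.mul_left (B + B))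
        (fun j => (hd j).mul_const _) (Eventually.of_forall fun k j => ?_)
      rw [norm_mul, norm_mul, norm_e, mul_one]
      exact mul_le_mul_of_nonneg_right (hD k j) (norm_nonneg _)
    have h2 := tendsto_nhds_unique h1 h0
    rw [← Function.Injective.tsum_eq (Nat.cast_injective (R := ℤ))] at h2
    · rw [← h2]
      refine tsum_congr fun j => ?_
      rw [Int.cast_natCast, e_natCast_mul, mul_assoc]
    · intro j hj
      by_contra hj'
      have : j < 0 := by
        by_contra h
        exact hj' ⟨j.toNat, by simp; omega⟩
      exact hj (by simp [hdneg j this])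
  have hs : Summable fun j : ℕ => ‖d j * w j‖ := by
    have h := (hws.mul_left (B + B)).comp_injective (Nat.cast_injective (R := ℤ))
    refine Summable.of_nonneg_of_le (fun j => norm_nonneg _) (fun j => ?_) h
    rw [norm_mul]
    exact mul_le_mul_of_nonneg_right (hdB j) (norm_nonneg _)
  have h := eq_zero_of_tsum_eq_zero_on_arc hs hδ0 hzero
  rcases mul_eq_zero.1 h with h | h
  · exact hd0 h
  · refine hφ0 ?_
    simpa [hw, e_zero] using h

/-! ### Uniform boundedness on a subinterval -/

/-- The sets where the sums are bounded by `M` are closed; the complement of the interval is added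
to each so that Baire's theorem applies on the whole line. -/
theorem exists_uniform_bound {a : ℕ → ℂ} (h : ContainsOpenInterval (boundedSet a)) :
    ∃ x δ M : ℝ, 0 < δ ∧ δ ≤ 1 ∧ ∀ θ ∈ Set.Ioo x (x + 2 * δ), ∀ N, ‖expSum a θ N‖ ≤ M := by
  obtain ⟨x, y, hxy, hE⟩ := h
  let F : ℕ → Set ℝ := fun M => {θ | ∀ N, ‖expSum a θ N‖ ≤ M} ∪ (Set.Ioo x y)ᶜ
  have hF : ∀ M, IsClosed (F M) := by
    intro M
    refine IsClosed.union ?_ isOpen_Ioo.isClosed_compl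
    rw [Set.ofPred_forall]
    exact isClosed_iInter fun N => isClosed_le (continuous_expSum a N).norm continuous_const
  have hU : ⋃ M, F M = Set.univ := by
    refine Set.eq_univ_of_forall fun θ => Set.mem_iUnion.2 ?_
    by_cases hθ : θ ∈ Set.Ioo x y
    · obtain ⟨C, hC⟩ := (hE hθ).2
      obtain ⟨M, hM⟩ := exists_nat_ge C
      exact ⟨M, Or.inl fun N => (hC ⟨N, rfl⟩).trans hM⟩
    · exact ⟨0, Or.inr hθ⟩
  obtain ⟨θ, hθ, hθU⟩ := (dense_iUnion_interior_of_closed hF hU).inter_open_nonempty _ isOpen_Ioo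
    (Set.nonempty_Ioo.2 hxy)
  obtain ⟨M, hM⟩ := Set.mem_iUnion.1 hθU
  obtain ⟨ε, hε, hball⟩ := Metric.isOpen_iff.1 (isOpen_interior.inter isOpen_Ioo) θ ⟨hM, hθ⟩
  refine ⟨θ, min (ε / 2) 1, M, by positivity, min_le_right _ _, fun t ht => ?_⟩
  have h1 : min (ε / 2) 1 ≤ ε / 2 := min_le_left _ _
  have h2 := hball (show t ∈ Metric.ball θ ε by
    rw [Real.ball_eq_Ioo]; exact ⟨by linarith [ht.1], by linarith [ht.2]⟩)
  exact (interior_subset h2.1).resolve_right fun h => h h2.2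

/-! ### Ultimate periodicity -/

/-- Two positions with the same window of length `L` exist by pigeonhole, and the sequence continues
from both in the same way. -/
theorem FinitelyManyValues.exists_period {a : ℕ → ℂ} (ha : FinitelyManyValues a) {L : ℕ}
    (hL : ∀ n m : ℕ, L < n → L < m → (∀ i, 1 ≤ i → i ≤ L → a (n - i) = a (m - i)) →
      a n = a m) :
    ∃ T K : ℕ, 0 < T ∧ ∀ n, K < n → a (n + T) = a n := by
  have : Finite (a '' Set.Ici 1) := ha
  let ψ : ℕ → (Fin L → a '' Set.Ici 1) := fun k i =>
    ⟨a (k + L - i), k + L - i, by simp; omega, rfl⟩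
  obtain ⟨p, q, hpq, hψ⟩ : ∃ p q, p < q ∧ ψ p = ψ q := by
    obtain ⟨p, q, hne, h⟩ := Finite.exists_ne_map_eq_of_infinite ψ
    rcases lt_or_gt_of_ne hne with hlt | hlt
    exacts [⟨p, q, hlt, h⟩, ⟨q, p, hlt, h.symm⟩]
  have hbase : ∀ i, i < L → a (p + L - i) = a (q + L - i) := fun i hi =>
    congrArg Subtype.val (congrFun hψ ⟨i, hi⟩)
  have key : ∀ i, a (p + L + 1 + i) = a (q + L + 1 + i) := by
    intro i
    induction i using Nat.strong_induction_on with
    | _ i ih =>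
      refine hL _ _ (by omega) (by omega) fun s hs1 hs2 => ?_
      by_cases hsi : s ≤ i
      · have h := ih (i - s) (by omega)
        rwa [← Nat.add_sub_assoc hsi, ← Nat.add_sub_assoc hsi] at h
      · have h := hbase (s - 1 - i) (by omega)
        rwa [show p + L + 1 + i - s = p + L - (s - 1 - i) by omega,
          show q + L + 1 + i - s = q + L - (s - 1 - i) by omega]
  refine ⟨q - p, p + L, by omega, fun n hn => ?_⟩
  have h := key (n - (p + L + 1))
  rw [show p + L + 1 + (n - (p + L + 1)) = n by omega,
    show q + L + 1 + (n - (p + L + 1)) = n + (q - p) by omega] at h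
  exact h.symm

/-! ### Periodic tails -/

theorem expSum_eq_sum_range (a : ℕ → ℂ) (α : ℝ) (N : ℕ) :
    expSum a α N = ∑ i ∈ Finset.range N, a (i + 1) * e ((i + 1 : ℕ) * α) := by
  rw [expSum, Finset.range_eq_Ico, Finset.sum_Ico_add' (fun n => a n * e ((n : ℕ) * α)) 0 N 1]
  rfl

theorem apply_add_mul_period {a : ℕ → ℂ} {T K : ℕ} (h : ∀ n, K < n → a (n + T) = a n)
    (k : ℕ) {n : ℕ} (hn : K < n) : a (n + k * T) = a n := by
  induction k with
  | zero => simp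
  | succ k ih => rw [add_mul, one_mul, ← add_assoc, h _ (by omega), ih]

/-- Over `k` periods the exponential sum grows by `k` times the sum over one period, so a bounded
exponential sum forces the latter to vanish. -/
theorem period_sum_eq_zero {a : ℕ → ℂ} {T K : ℕ} (h : ∀ n, K < n → a (n + T) = a n) {α : ℝ}
    (hα : e α ^ T = 1) (hb : α ∈ boundedSet a) :
    ∑ i ∈ Finset.range T, a (K + 1 + i) * e α ^ i = 0 := by
  set S := ∑ i ∈ Finset.range T, a (K + 1 + i) * e α ^ i with hS
  have hsum : ∀ k : ℕ, expSum a α (K + k * T) = expSum a α K + k * (e α ^ (K + 1) * S) := by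
    intro k
    induction k with
    | zero => simp
    | succ k ih =>
      rw [add_mul, one_mul, ← add_assoc, expSum_eq_sum_range, Finset.sum_range_add,
        ← expSum_eq_sum_range, ih]
      have : ∑ i ∈ Finset.range T, a (K + k * T + i + 1) * e ((K + k * T + i + 1 : ℕ) * α)
          = e α ^ (K + 1) * S := by
        rw [hS, Finset.mul_sum]
        refine Finset.sum_congr rfl fun i _ => ?_
        rw [show K + k * T + i + 1 = K + 1 + i + k * T by ring,
          apply_add_mul_period h k (by omega), e_natCast_mul, pow_add, mul_comm k T, pow_mul, hα,
          one_pow, pow_add]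
        ring
      rw [this]
      push_cast
      ring
  obtain ⟨C, hC⟩ := hb.2
  by_contra hne
  have hpos : 0 < ‖S‖ := norm_pos_iff.2 hne
  obtain ⟨k, hk⟩ := exists_nat_gt ((C + ‖expSum a α K‖) / ‖S‖)
  rw [div_lt_iff₀ hpos] at hk
  have h1 : ‖expSum a α (K + k * T)‖ ≤ C := hC ⟨_, rfl⟩
  have h2 : (k : ℝ) * ‖S‖ ≤ ‖expSum a α (K + k * T)‖ + ‖expSum a α K‖ := by
    have h3 : (k : ℂ) * (e α ^ (K + 1) * S) = expSum a α (K + k * T) - expSum a α K := by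
      rw [hsum]; ring
    have h4 : ‖(k : ℂ) * (e α ^ (K + 1) * S)‖ = k * ‖S‖ := by
      simp [norm_e]
    rw [← h4, h3]
    exact norm_sub_le _ _
  linarith

open Polynomial in
theorem ultimatelyConstant_of_periodic {a : ℕ → ℂ} {T K : ℕ} (hT : 0 < T)
    (h : ∀ n, K < n → a (n + T) = a n)
    (hQ : Set.range ((↑) : ℚ → ℝ) ∩ Set.Ioo 0 1 ⊆ boundedSet a) : UltimatelyConstant a := by
  have hT0 : (0 : ℝ) < T := by exact_mod_cast hT
  obtain ⟨t, rfl⟩ : ∃ t, T = t + 1 := ⟨T - 1, by omega⟩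
  set c := a (K + 1 + t) with hc
  have hprim : IsPrimitiveRoot (e (1 / (t + 1 : ℕ))) (t + 1) := by
    convert Complex.isPrimitiveRoot_exp (t + 1) (by omega) using 1
    rw [e]
    push_cast
    ring_nf
  have hpow : ∀ r : ℕ, e (r / (t + 1 : ℕ)) = e (1 / (t + 1 : ℕ)) ^ r := by
    intro r
    rw [← e_natCast_mul, mul_one_div]
  -- Subtracting the last coefficient `c` from the period polynomial lowers its degree below the
  -- number `t` of nontrivial roots of unity of order `t + 1`, without changing its values there.
  let Q : ℂ[X] := ∑ i ∈ Finset.range t, C (a (K + 1 + i) - c) * X ^ i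
  have hcoeff : ∀ i, i < t → Q.coeff i = a (K + 1 + i) - c := by
    intro i hi
    simp only [Q, finsetSum_coeff, coeff_C_mul, coeff_X_pow]
    simp [hi]
  have hroot : ∀ r : Fin t, Q.eval (e ((r + 1 : ℕ) / (t + 1 : ℕ))) = 0 := by
    intro r
    set α : ℝ := (r + 1 : ℕ) / (t + 1 : ℕ) with hα
    have hαT : e α ^ (t + 1) = 1 := by
      rw [hα, hpow, ← pow_mul, mul_comm, pow_mul, hprim.pow_eq_one, one_pow]
    have hα1 : e α ≠ 1 := by
      rw [hα, hpow]
      exact hprim.pow_ne_one_of_pos_of_lt (by omega) (by omega)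
    have hmem : α ∈ boundedSet a := by
      refine hQ ⟨⟨(r + 1 : ℕ) / (t + 1 : ℕ), by rw [hα]; push_cast; rfl⟩, by positivity, ?_⟩
      rw [hα, div_lt_one hT0]
      exact_mod_cast (by omega : (r : ℕ) + 1 < t + 1)
    have hgeom : ∑ i ∈ Finset.range (t + 1), e α ^ i = 0 := by
      rw [geom_sum_eq hα1, hαT, sub_self, zero_div]
    have hper := period_sum_eq_zero h hαT hmem
    have hsub : ∑ i ∈ Finset.range (t + 1), (a (K + 1 + i) - c) * e α ^ i = 0 := by
      simp_rw [sub_mul, Finset.sum_sub_distrib, hper, ← Finset.mul_sum, hgeom]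
      simp
    rw [Finset.sum_range_succ, ← hc, sub_self, zero_mul, add_zero] at hsub
    simpa [Q, eval_finsetSum] using hsub
  have hinj : Function.Injective fun r : Fin t => e ((r + 1 : ℕ) / (t + 1 : ℕ)) := by
    intro r s hrs
    simp only [hpow] at hrs
    have := hprim.pow_inj (by omega) (by omega) hrs
    exact Fin.ext (by omega)
  have hval : ∀ i, i < t + 1 → a (K + 1 + i) = c := by
    intro i hi
    rcases Nat.lt_succ_iff_lt_or_eq.1 hi with hi | rfl
    · have hdeg : Q.natDegree < t := by
        refine (natDegree_sum_le_of_forall_le (n := t - 1) _ _ fun j hj => ?_).trans_lt (by omega)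
        refine (natDegree_C_mul_X_pow_le _ _).trans ?_
        have := Finset.mem_range.1 hj
        omega
      have hQ0 := eq_zero_of_natDegree_lt_card_of_eval_eq_zero Q hinj hroot (by simpa using hdeg)
      have := hcoeff i hi
      rw [hQ0, coeff_zero] at this
      exact (sub_eq_zero.1 this.symm)
    · rfl
  refine ⟨c, K + 1, fun n hn => ?_⟩
  rw [← hval ((n - (K + 1)) % (t + 1)) (Nat.mod_lt _ hT),
    ← apply_add_mul_period h ((n - (K + 1)) / (t + 1))
      (n := K + 1 + (n - (K + 1)) % (t + 1)) (by omega)]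
  congr 1
  have := Nat.mod_add_div (n - (K + 1)) (t + 1)
  rw [mul_comm] at this
  omega

/-! ### Conclusion -/

theorem ultimatelyConstant_of_boundedSet {a : ℕ → ℂ} (ha : FinitelyManyValues a)
    (hE : ContainsOpenInterval (boundedSet a))
    (hQ : Set.range ((↑) : ℚ → ℝ) ∩ Set.Ioo 0 1 ⊆ boundedSet a) : UltimatelyConstant a := by
  obtain ⟨x, δ, M, hδ0, hδ, hM⟩ := exists_uniform_bound hE
  obtain ⟨L, hL⟩ := determined_by_past ha hδ0 hδ hM
  obtain ⟨T, K, hT, hper⟩ := ha.exists_period hL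
  exact ultimatelyConstant_of_periodic hT hper hQ

theorem expSum_one_sub {a : ℕ → ℂ} (ha : ∀ n, 1 ≤ n → (a n).im = 0) (α : ℝ) (N : ℕ) :
    expSum a (1 - α) N = (starRingEnd ℂ) (expSum a α N) := by
  rw [expSum, expSum, map_sum]
  refine Finset.sum_congr rfl fun n hn => ?_
  rw [map_mul, Complex.conj_eq_iff_im.2 (ha n (Finset.mem_Icc.1 hn).1), conj_e, mul_sub, mul_one,
    sub_eq_add_neg, e_add]
  have := e_intCast n
  rw [Int.cast_natCast] at this
  rw [this, one_mul]

theorem one_sub_mem_boundedSet {a : ℕ → ℂ} (ha : ∀ n, 1 ≤ n → (a n).im = 0) {α : ℝ}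
    (hα : α ∈ boundedSet a) : 1 - α ∈ boundedSet a := by
  obtain ⟨⟨h0, h1⟩, hb⟩ := hα
  refine ⟨⟨by linarith, by linarith⟩, ?_⟩
  simpa only [expSum_one_sub ha, RCLike.norm_conj] using hb

open Classical in
theorem expSum_indicator (A : Set ℕ) (α : ℝ) (N : ℕ) :
    expSum (A.indicator 1) α N = setExpSum A α N := by
  rw [expSum, setExpSum, Finset.sum_filter]
  refine Finset.sum_congr rfl fun n _ => ?_
  by_cases h : n ∈ A <;> simp [h]

theorem not_hasBES_of_infinite_of_infinite_compl {A : Set ℕ} (hA : A.Infinite)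
    (hAc : Aᶜ.Infinite) : ¬ HasBES A (Set.Ioo 0 1) := by
  intro hbes
  have hsub : Set.Ioo 0 1 ⊆ boundedSet (A.indicator 1) := by
    intro α hα
    obtain ⟨C, -, hC⟩ := hbes α hα
    refine ⟨hα, C, ?_⟩
    rintro _ ⟨N, rfl⟩
    simpa only [expSum_indicator] using hC N
  have hfin : FinitelyManyValues (A.indicator 1) := by
    refine (Set.toFinite {(0 : ℂ), 1}).subset ?_
    rintro _ ⟨n, -, rfl⟩
    by_cases h : n ∈ A <;> simp [h]
  obtain ⟨c, K, hc⟩ := ultimatelyConstant_of_boundedSet hfin ⟨0, 1, one_pos, hsub⟩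
    (Set.inter_subset_right.trans hsub)
  obtain ⟨n, hnA, hn⟩ := hA.exists_gt K
  obtain ⟨m, hmA, hm⟩ := hAc.exists_gt K
  have h := (hc n hn.le).trans (hc m hm.le).symm
  rw [Set.indicator_of_mem hnA, Set.indicator_of_notMem hmA] at h
  exact one_ne_zero h

end BoundedExpSums

theorem mainTheorem1 :
    (∀ a : ℕ → ℂ, BoundedExpSums.FinitelyManyValues a →
      BoundedExpSums.ContainsOpenInterval (BoundedExpSums.boundedSet a) →
      Set.range ((↑) : ℚ → ℝ) ∩ Set.Ioo 0 1 ⊆ BoundedExpSums.boundedSet a →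
      BoundedExpSums.UltimatelyConstant a) ∧
    (∀ a : ℕ → ℂ, (∀ n : ℕ, 1 ≤ n → (a n).im = 0) → BoundedExpSums.FinitelyManyValues a →
      BoundedExpSums.ContainsOpenInterval (BoundedExpSums.boundedSet a) →
      Set.range ((↑) : ℚ → ℝ) ∩ Set.Ioc 0 (1 / 2) ⊆ BoundedExpSums.boundedSet a →
      BoundedExpSums.UltimatelyConstant a) ∧
    ¬ ∃ A : Set ℕ, A.Infinite ∧ Aᶜ.Infinite ∧ BoundedExpSums.HasBES A (Set.Ioo 0 1) := by
  refine ⟨fun a ha hE hQ => BoundedExpSums.ultimatelyConstant_of_boundedSet ha hE hQ,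
    fun a hre ha hE hQ => BoundedExpSums.ultimatelyConstant_of_boundedSet ha hE ?_,
    fun ⟨A, hA, hAc, hbes⟩ =>
      BoundedExpSums.not_hasBES_of_infinite_of_infinite_compl hA hAc hbes⟩
  rintro _ ⟨⟨q, rfl⟩, h0, h1⟩
  rcases le_or_gt (q : ℝ) (1 / 2) with h | h
  · exact hQ ⟨⟨q, rfl⟩, h0, h⟩
  · have hmem := hQ ⟨⟨1 - q, rfl⟩, by push_cast; linarith, by push_cast; linarith⟩
    have := BoundedExpSums.one_sub_mem_boundedSet hre hmem
    simpa using this
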